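/- **Setting.** A crossed module of topological groups $(H,G)$ consists of topological groups $G,H$, a continuous homomorphism $t\colon G\to H$ and a continuous action $\alpha$ of $H$ on $G$ by automorphisms such that $t(\alpha(h)(g))=h\,t(g)\,h^{-1}$ and $\alpha(t(g))(g')=g g' g^{-1}$ for all $h\in H$, $g,g'\in G$. Assume that the projections $G\to G/\ker(t)$ and $H\to H/t(G)$ admit local sections, and that the canonical bijection $G/\ker(t)\to t(G)$ is a homeomorphism (where $G/\ker(t)$ has the quotient topology and $t(G)\subset H$ the subspace topology). An *$(H,G)$ bibundle* on a space $N$ is a locally trivial right principal $G$-bundle $P\to N$ together with a continuous map $\psi\colon P\to H$, its structure map, such that $\psi(pg)=\psi(p)t(g)$ for all $p\in P$, $g\in G$. Its *type map* is the continuous map $\phi\colon N\to H/t(G)$ sending $n$ to the class of $\psi(p)$ for any $p$ in the fibre over $n$. Along a continuous map $f\colon M\to N$ it pulls back to the bibundle $f^*P=M\times_N P$ on $M$ with structure map $(m,p)\mapsto\psi(p)$. Two bibundles on $M$ are *isomorphic* if there is an isomorphism of principal $G$-bundles between them, covering the identity of $M$, that commutes with the structure maps. **Proposition.** Let $P$ be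 an $(H,G)$ bibundle on a space $N$ with type map $\phi\colon N\to H/t(G)$, and regard $N$ as a space over $H/t(G)$ by means of $\phi$. Let $M$ be a paracompact Hausdorff space over $H/t(G)$, with structure map $\tau\colon M\to H/t(G)$, and let $f_0,f_1\colon M\to N$ be maps that are homotopic over $H/t(G)$, i.e. there is a homotopy $h\colon M\times[0,1]\to N$ from $f_0$ to $f_1$ with $\phi(h(m,s))=\tau(m)$ for all $m\in M$ and $s\in[0,1]$. Then the bibundles $f_0^*P$ and $f_1^*P$ on $M$ are isomorphic. -/

import Mathlib

open scoped Topology RightActions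

universe uH uG uM uN uP

/-- A (topological) crossed module `t : G → H`, `α : H → Aut(G)`: continuous homomorphism `t`,
continuous action `α` of `H` on `G` by automorphisms, with `t (α(h)(g)) = h t(g) h⁻¹` and
`α ∘ t = Ad_G`. -/
structure TopCrossedModule (H : Type uH) (G : Type uG)
    [Group H] [TopologicalSpace H] [Group G] [TopologicalSpace G] where
  /-- the boundary homomorphism -/
  t : G →* H
  continuous_t : Continuous t
  /-- the action of `H` on `G` -/
  α : H →* MulAut G
  continuous_α : Continuous fun x : H × G => α x.1 x.2
  t_α : ∀ (h : H) (g : G), t (α h g) = h * t g * h⁻¹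
  α_t : ∀ g g' : G, α (t g) g' = g * g' * g⁻¹

/-- A map `q : X → Y` admits local sections: near each point of `Y` it has a continuous
section. -/
def AdmitsLocalSections {X : Type*} {Y : Type*} [TopologicalSpace X] [TopologicalSpace Y]
    (q : X → Y) : Prop :=
  ∀ y : Y, ∃ U : Set Y, IsOpen U ∧ y ∈ U ∧
    ∃ s : Y → X, ContinuousOn s U ∧ ∀ z ∈ U, q (s z) = z

/-- `f₀` and `f₁` are homotopic in the category of spaces over `B`, where `X` and `Y` are spaces
over `B` by means of `pX` and `pY`: there is a homotopy from `f₀` to `f₁` all of whose stages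
are maps over `B`. -/
def HomotopicOver {B : Type*} {X : Type*} {Y : Type*}
    [TopologicalSpace B] [TopologicalSpace X] [TopologicalSpace Y]
    (pX : C(X, B)) (pY : C(Y, B)) (f₀ f₁ : C(X, Y)) : Prop :=
  f₀.HomotopicWith f₁ fun f => pY.comp f = pX

/-- `π : P → M`, with the right action of `G` on `P`, is a (locally trivial) principal
`G`-bundle: each point of `M` lies in an open set `U` over which `P` is isomorphic to `U × G`,
by a homeomorphism over `U` that is equivariant for right multiplication on `G`. -/
structure IsPrincipalBundle (G : Type uG) [Group G] [TopologicalSpace G]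
    {P : Type uP} [TopologicalSpace P] [MulAction Gᵐᵒᵖ P]
    {M : Type uM} [TopologicalSpace M] (π : P → M) : Prop where
  continuous_proj : Continuous π
  continuous_act : Continuous fun x : P × G => x.1 <• x.2
  proj_act : ∀ (p : P) (g : G), π (p <• g) = π p
  locally_trivial : ∀ m : M, ∃ e : Bundle.Trivialization G π, m ∈ e.baseSet ∧
    ∀ p : P, π p ∈ e.baseSet → ∀ g : G, (e (p <• g)).2 = (e p).2 * g

namespace IsPrincipalBundle

variable {G : Type uG} [Group G] [TopologicalSpace G]
  {P : Type uP} [TopologicalSpace P] [MulAction Gᵐᵒᵖ P]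
  {M : Type uM} [TopologicalSpace M] {π : P → M}

theorem surjective (h : IsPrincipalBundle G π) : Function.Surjective π := by
  intro m
  obtain ⟨e, hm, -⟩ := h.locally_trivial m
  exact ⟨e.toOpenPartialHomeomorph.symm (m, 1), e.proj_symm_apply' hm⟩

theorem isOpenMap (h : IsPrincipalBundle G π) : IsOpenMap π := by
  rw [isOpenMap_iff_nhds_le]
  intro p
  obtain ⟨e, hm, -⟩ := h.locally_trivial (π p)
  exact (e.map_proj_nhds (e.mem_source.2 hm)).ge

theorem isQuotientMap (h : IsPrincipalBundle G π) : Topology.IsQuotientMap π :=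
  h.isOpenMap.isQuotientMap h.continuous_proj h.surjective

/-- Two points of the same fibre differ by an element of the group. -/
theorem exists_act_eq (h : IsPrincipalBundle G π) {p q : P} (hpq : π p = π q) :
    ∃ g : G, p <• g = q := by
  obtain ⟨e, hm, he⟩ := h.locally_trivial (π p)
  refine ⟨((e p).2)⁻¹ * (e q).2, ?_⟩
  have hp : π (p <• (((e p).2)⁻¹ * (e q).2)) = π p := h.proj_act _ _
  refine e.injOn (e.mem_source.2 (hp ▸ hm)) (e.mem_source.2 (hpq ▸ hm)) (Prod.ext ?_ ?_)
  · exact (e.coe_fst' (hp ▸ hm)).trans (hp.trans (hpq.trans (e.coe_fst' (hpq ▸ hm)).symm))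
  · exact (he p hm _).trans (mul_inv_cancel_left _ _)

end IsPrincipalBundle

/-- The fibre product `M ×_N P`, as a subspace of `M × P`. -/
abbrev FibreProduct {M : Type uM} {N : Type uN} {P : Type uP} (f : M → N) (π : P → N) :
    Type (max uM uP) :=
  {x : M × P // f x.1 = π x.2}

/-- An `(H, G)` bibundle on `M`: a right principal `G`-bundle `π : P → M` with a continuous map
`ψ : P → H` (the structure map) such that `ψ (p g) = ψ (p) t (g)`. -/
structure Bibundle {H : Type uH} {G : Type uG}
    [Group H] [TopologicalSpace H] [Group G] [TopologicalSpace G]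
    (X : TopCrossedModule H G) (M : Type uM) [TopologicalSpace M] where
  /-- the total space -/
  P : Type uP
  [topP : TopologicalSpace P]
  [actP : MulAction Gᵐᵒᵖ P]
  /-- the projection -/
  π : P → M
  isPrincipal : IsPrincipalBundle G π
  /-- the structure map -/
  ψ : P → H
  continuous_ψ : Continuous ψ
  ψ_act : ∀ (p : P) (g : G), ψ (p <• g) = ψ p * X.t g

attribute [instance] Bibundle.topP Bibundle.actP

namespace Bibundle

variable {H : Type uH} {G : Type uG}
  [Group H] [TopologicalSpace H] [Group G] [TopologicalSpace G]
  {X : TopCrossedModule H G} {M : Type uM} [TopologicalSpace M] {N : Type uN} [TopologicalSpace N]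

/-- Two bibundles on `M` are isomorphic: there is a homeomorphism of the total spaces that covers
the identity of `M` and commutes with the right actions and with the structure maps. -/
def Isomorphic (P Q : Bibundle.{uH, uG, uM, uP} X M) : Prop :=
  ∃ F : P.P ≃ₜ Q.P, (∀ p, Q.π (F p) = P.π p) ∧ (∀ (p : P.P) (g : G), F (p <• g) = F p <• g) ∧
    ∀ p, Q.ψ (F p) = P.ψ p

theorem type_well_defined (P : Bibundle.{uH, uG, uM, uP} X M) {p q : P.P} (h : P.π p = P.π q) :
    (P.ψ p : H ⧸ X.t.range) = (P.ψ q : H ⧸ X.t.range) := by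
  obtain ⟨g, rfl⟩ := P.isPrincipal.exists_act_eq h
  rw [P.ψ_act, QuotientGroup.eq]
  exact ⟨g, by group⟩

/-- The type map `M → H/t(G)` of a bibundle: the class of `ψ (p)` for any point `p` of the fibre
(see `typeMap_apply`). -/
noncomputable def typeMap (P : Bibundle.{uH, uG, uM, uP} X M) : C(M, H ⧸ X.t.range) where
  toFun m := (P.ψ (Function.surjInv P.isPrincipal.surjective m) : H ⧸ X.t.range)
  continuous_toFun := by
    rw [P.isPrincipal.isQuotientMap.continuous_iff]
    refine (QuotientGroup.continuous_mk.comp P.continuous_ψ).congr fun p => ?_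
    exact P.type_well_defined (Function.surjInv_eq P.isPrincipal.surjective (P.π p)).symm

theorem typeMap_apply (P : Bibundle.{uH, uG, uM, uP} X M) (p : P.P) :
    P.typeMap (P.π p) = (P.ψ p : H ⧸ X.t.range) :=
  P.type_well_defined (Function.surjInv_eq P.isPrincipal.surjective (P.π p))

/-- The right action of `G` on `M ×_N P` through the second factor. -/
@[reducible] def pullbackAction (P : Bibundle.{uH, uG, uN, uP} X N) (f : M → N) :
    MulAction Gᵐᵒᵖ (FibreProduct f P.π) where
  smul a x := ⟨(x.1.1, a • x.1.2),
    x.2.trans (P.isPrincipal.proj_act x.1.2 (MulOpposite.unop a)).symm⟩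
  one_smul x := Subtype.ext (Prod.ext rfl (one_smul Gᵐᵒᵖ x.1.2))
  mul_smul a b x := Subtype.ext (Prod.ext rfl (mul_smul a b x.1.2))

/-- The pullback of a trivialization of `π : P → N` along `f : M → N`. -/
noncomputable def pullbackTrivialization (P : Bibundle.{uH, uG, uN, uP} X N) (f : C(M, N))
    (e : Bundle.Trivialization G P.π) :
    Bundle.Trivialization G (fun x : FibreProduct f P.π => x.1.1) := by
  classical
  exact
  { toFun := fun x => (x.1.1, (e x.1.2).2)
    invFun := fun y =>
      if h : f y.1 ∈ e.baseSet then
        ⟨(y.1, e.toOpenPartialHomeomorph.symm (f y.1, y.2)), (e.proj_symm_apply' h).symm⟩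
      else ⟨(y.1, Function.surjInv P.isPrincipal.surjective (f y.1)),
        (Function.surjInv_eq P.isPrincipal.surjective (f y.1)).symm⟩
    source := (fun x : FibreProduct f P.π => x.1.1) ⁻¹' (f ⁻¹' e.baseSet)
    target := (f ⁻¹' e.baseSet) ×ˢ Set.univ
    map_source' := fun x hx => ⟨hx, trivial⟩
    map_target' := fun y hy => by
      have h : f y.1 ∈ e.baseSet := hy.1
      simp only [dif_pos h]
      exact h
    left_inv' := fun x hx => by
      have h : f x.1.1 ∈ e.baseSet := hx
      simp only [dif_pos h]
      refine Subtype.ext (Prod.ext rfl ?_)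
      have h2 : P.π x.1.2 ∈ e.baseSet := x.2 ▸ h
      have := e.symm_apply_mk_proj (e.mem_source.2 h2)
      rwa [← x.2] at this
    right_inv' := fun y hy => by
      have h : f y.1 ∈ e.baseSet := hy.1
      simp only [dif_pos h]
      refine Prod.ext rfl ?_
      change (e (e.toOpenPartialHomeomorph.symm (f y.1, y.2))).2 = y.2
      rw [e.apply_symm_apply' h]
    open_source := (e.open_baseSet.preimage f.continuous).preimage
      (continuous_fst.comp continuous_subtype_val)
    open_target := (e.open_baseSet.preimage f.continuous).prod isOpen_univ
    continuousOn_toFun := by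
      refine (continuous_fst.comp continuous_subtype_val).continuousOn.prodMk ?_
      have hg : ContinuousOn (fun x : FibreProduct f P.π => x.1.2)
          ((fun x : FibreProduct f P.π => x.1.1) ⁻¹' (f ⁻¹' e.baseSet)) :=
        (continuous_snd.comp continuous_subtype_val).continuousOn
      suffices he : ContinuousOn (fun x : FibreProduct f P.π => e x.1.2)
          ((fun x : FibreProduct f P.π => x.1.1) ⁻¹' (f ⁻¹' e.baseSet))
        from continuous_snd.comp_continuousOn he
      refine e.toOpenPartialHomeomorph.continuousOn.comp hg ?_
      intro x hx
      exact e.mem_source.2 (x.2 ▸ hx : P.π x.1.2 ∈ e.baseSet)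
    continuousOn_invFun := by
      refine (Topology.IsInducing.subtypeVal (t := {x : M × P.P | f x.1 = P.π x.2})).continuousOn_iff.2 ?_
      have h1 : ContinuousOn (fun y : M × G =>
          (y.1, e.toOpenPartialHomeomorph.symm (f y.1, y.2)))
          ((f ⁻¹' e.baseSet) ×ˢ Set.univ) := by
        refine continuous_fst.continuousOn.prodMk (e.toOpenPartialHomeomorph.continuousOn_symm.comp
          ((f.continuous.comp continuous_fst).prodMk continuous_snd).continuousOn ?_)
        intro y hy
        exact e.mem_target.2 hy.1
      refine h1.congr ?_
      intro y hy
      have h : f y.1 ∈ e.baseSet := hy.1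
      simp only [Function.comp_apply, dif_pos h]
    baseSet := f ⁻¹' e.baseSet
    open_baseSet := e.open_baseSet.preimage f.continuous
    source_eq := rfl
    target_eq := rfl
    proj_toFun := fun x _ => rfl }

/-- The pullback `f^*P = M ×_N P` of a bibundle on `N` along a continuous map `f : M → N`, with
`(m, p) g = (m, p g)` and structure map `(m, p) ↦ ψ (p)`. -/
@[simps P π ψ]
noncomputable def pullback (P : Bibundle.{uH, uG, uN, uP} X N) (f : C(M, N)) :
    Bibundle.{uH, uG, uM, max uM uP} X M where
  P := FibreProduct f P.π
  topP := inferInstance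
  actP := P.pullbackAction f
  π x := x.1.1
  isPrincipal :=
    letI := P.pullbackAction f
    { continuous_proj := continuous_fst.comp continuous_subtype_val
      continuous_act := by
        refine Continuous.subtype_mk (Continuous.prodMk ?_ ?_) _
        · exact continuous_fst.comp (continuous_subtype_val.comp continuous_fst)
        · exact P.isPrincipal.continuous_act.comp
            ((continuous_snd.comp (continuous_subtype_val.comp continuous_fst)).prodMk
              continuous_snd)
      proj_act := fun _ _ => rfl
      locally_trivial := fun m => by
        obtain ⟨e, hm, he⟩ := P.isPrincipal.locally_trivial (f m)
        refine ⟨P.pullbackTrivialization f e, hm, fun x hx g => he x.1.2 ?_ g⟩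
        exact x.2 ▸ (hx : f x.1.1 ∈ e.baseSet) }
  ψ x := P.ψ x.1.2
  continuous_ψ := P.continuous_ψ.comp (continuous_snd.comp continuous_subtype_val)
  ψ_act x g := P.ψ_act x.1.2 g

end Bibundle

/-! Pull `P` back along the homotopy to a bibundle `Q` on `M × [0,1]`. As the homotopy lies over
`H/t(G)`, the type map of `Q` depends on `m` alone, so near each point of `M` it lifts to a
continuous `η` with values in `H` that is constant in the interval direction. A local section `s` of
`Q` satisfies `ψ(s) = η t(g)`; local sections of `G → t(G)` make `g` continuous, and `s g⁻¹` is a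
flat section, one with `ψ = η`. Two flat sections differ by a function into `ker t`, so they can be
glued along the interval (`exists_glue`), and compactness of `[0,1]` gives flat sections over `W ×
[0,1]` (`exists_isFlatSection`).

Translation along a flat section is equivariant and preserves `ψ`, because `η` ignores the interval
coordinate. As in the classical proof of homotopy invariance for principal bundles, the translations
by the functions of a partition of unity compose to a total shift of `1` (`exists_transport`). This
carries `Q` over `M × {0}` to `Q` over `M × {1}`, and an equivariant map over the identity is an
isomorphism (`exists_homeomorph`). -/

theorem rightAction_rightAction {G : Type*} [Group G] {P : Type*} [MulAction Gᵐᵒᵖ P]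
    (p : P) (g g' : G) : (p <• g) <• g' = p <• (g * g') := by
  rw [MulOpposite.op_mul, mul_smul]

/-! ### Division in the fibres and morphisms of principal bundles -/

namespace IsPrincipalBundle

variable {G : Type uG} [Group G] [TopologicalSpace G]
  {P : Type uP} [TopologicalSpace P] [MulAction Gᵐᵒᵖ P]
  {M : Type uM} [TopologicalSpace M] {π : P → M}

/-- The element of `G` carrying `p` to `q`, for points `p`, `q` of the same fibre. -/
noncomputable def divide (h : IsPrincipalBundle G π) (p q : P) : G := by
  classical exact if hpq : π p = π q then (h.exists_act_eq hpq).choose else 1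

theorem act_divide (h : IsPrincipalBundle G π) {p q : P} (hpq : π p = π q) :
    p <• h.divide p q = q := by
  rw [divide, dif_pos hpq]
  exact (h.exists_act_eq hpq).choose_spec

theorem act_injective (h : IsPrincipalBundle G π) (p : P) {g g' : G}
    (hg : p <• g = p <• g') : g = g' := by
  obtain ⟨e, hm, he⟩ := h.locally_trivial (π p)
  have := congrArg (fun x => (e x).2) hg
  simpa only [he p hm, mul_right_inj] using this

theorem divide_eq_iff (h : IsPrincipalBundle G π) {p q : P} (hpq : π p = π q) {g : G} :
    h.divide p q = g ↔ p <• g = q :=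
  ⟨fun hg => hg ▸ h.act_divide hpq,
    fun hg => h.act_injective p ((h.act_divide hpq).trans hg.symm)⟩

theorem divide_act (h : IsPrincipalBundle G π) {p q : P} (hpq : π p = π q) (g : G) :
    h.divide p (q <• g) = h.divide p q * g := by
  rw [h.divide_eq_iff (hpq.trans (h.proj_act q g).symm), ← rightAction_rightAction, h.act_divide hpq]

/-- In an equivariant trivialization `e`, the quotient of `p` and `q` is `(e p).2⁻¹ * (e q).2`. -/
theorem continuousOn_divide [IsTopologicalGroup G] (h : IsPrincipalBundle G π) :
    ContinuousOn (fun x : P × P => h.divide x.1 x.2) {x | π x.1 = π x.2} := by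
  rintro ⟨p, q⟩ hpq
  obtain ⟨e, hm, he⟩ := h.locally_trivial (π p)
  have hpq' : π p = π q := hpq
  have hp : p ∈ e.source := e.mem_source.2 hm
  have hq : q ∈ e.source := e.mem_source.2 (hpq' ▸ hm)
  have hs : e.source ×ˢ e.source ∈ 𝓝 (p, q) :=
    (e.open_source.prod e.open_source).mem_nhds ⟨hp, hq⟩
  have key : ∀ x ∈ {x : P × P | π x.1 = π x.2} ∩ e.source ×ˢ e.source,
      h.divide x.1 x.2 = ((e x.1).2)⁻¹ * (e x.2).2 := by
    rintro ⟨a, b⟩ ⟨hab, ha, -⟩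
    have := he a (e.mem_source.1 ha) (h.divide a b)
    rw [h.act_divide hab] at this
    rw [this, inv_mul_cancel_left]
  have hc : ContinuousOn (fun x : P × P => ((e x.1).2)⁻¹ * (e x.2).2)
      (e.source ×ˢ e.source) := by
    refine ContinuousOn.mul (ContinuousOn.inv ?_) ?_
    · exact continuous_snd.comp_continuousOn
        (e.continuousOn_toFun.comp continuous_fst.continuousOn fun x hx => hx.1)
    · exact continuous_snd.comp_continuousOn
        (e.continuousOn_toFun.comp continuous_snd.continuousOn fun x hx => hx.2)
  exact (continuousWithinAt_inter hs).1 (((hc.mono Set.inter_subset_right).congr key) (p, q)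
    ⟨hpq, hp, hq⟩)

/-- A principal bundle has continuous local sections. -/
theorem exists_local_section (h : IsPrincipalBundle G π) (m : M) :
    ∃ U : Set M, IsOpen U ∧ m ∈ U ∧ ∃ s : M → P, ContinuousOn s U ∧ ∀ x ∈ U, π (s x) = x := by
  obtain ⟨e, hm, -⟩ := h.locally_trivial m
  refine ⟨e.baseSet, e.open_baseSet, hm, fun x => e.toOpenPartialHomeomorph.symm (x, 1), ?_,
    fun x hx => e.proj_symm_apply' hx⟩
  exact e.toOpenPartialHomeomorph.continuousOn_symm.comp
    (continuous_id.prodMk continuous_const).continuousOn fun x hx => e.mem_target.2 hx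

/-- A continuous equivariant map of principal bundles over the identity is a homeomorphism. -/
theorem exists_homeomorph [IsTopologicalGroup G] {P' : Type*} [TopologicalSpace P']
    [MulAction Gᵐᵒᵖ P'] {π' : P' → M} (h : IsPrincipalBundle G π) (h' : IsPrincipalBundle G π')
    (F : P → P') (hF : Continuous F) (hπ : ∀ p, π' (F p) = π p)
    (hact : ∀ (p : P) (g : G), F (p <• g) = F p <• g) :
    ∃ F' : P ≃ₜ P', ∀ p, F' p = F p := by
  have hinj : Function.Injective F := by
    intro p q hpq
    have hb : π p = π q := by rw [← hπ, hpq, hπ]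
    have h1 := h.act_divide hb
    have h2 : F p <• h.divide p q = F p <• (1 : G) := by
      rw [← hact, h1, MulOpposite.op_one, one_smul, hpq]
    rw [h'.act_injective _ h2, MulOpposite.op_one, one_smul] at h1
    exact h1
  have hsurj : Function.Surjective F := by
    intro q
    obtain ⟨p, hp⟩ := h.surjective (π' q)
    have hb : π' (F p) = π' q := (hπ p).trans hp
    exact ⟨p <• h'.divide (F p) q, (hact _ _).trans (h'.act_divide hb)⟩
  let E := Equiv.ofBijective F ⟨hinj, hsurj⟩
  refine ⟨⟨E, hF, ?_⟩, fun p => rfl⟩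
  change Continuous E.symm
  rw [continuous_iff_continuousAt]
  intro q
  obtain ⟨U, hU, hq, s, hs, hsU⟩ := h.exists_local_section (π' q)
  -- The inverse is computed by comparing `x` with the image under `F` of a local section;
  -- equivariance carries the quotient back to `P`.
  have key : ∀ x ∈ π' ⁻¹' U, E.symm x = s (π' x) <• h'.divide (F (s (π' x))) x := by
    intro x hx
    rw [Equiv.symm_apply_eq]
    change x = F _
    rw [hact, h'.act_divide ((hπ _).trans (hsU _ hx))]
  have hs' : ContinuousOn (fun x => s (π' x)) (π' ⁻¹' U) :=
    hs.comp h'.continuous_proj.continuousOn fun x hx => hx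
  have hc : ContinuousOn (fun x => s (π' x) <• h'.divide (F (s (π' x))) x) (π' ⁻¹' U) :=
    h.continuous_act.comp_continuousOn (hs'.prodMk (h'.continuousOn_divide.comp
      ((hF.comp_continuousOn hs').prodMk continuousOn_id)
      fun x hx => (hπ _).trans (hsU _ hx)))
  exact (hc.congr key).continuousAt ((hU.preimage h'.continuous_proj).mem_nhds hq)

end IsPrincipalBundle

/-! ### Local sections of the boundary homomorphism onto its image -/

namespace TopCrossedModule

variable {H : Type uH} {G : Type uG} [Group H] [TopologicalSpace H]
  [Group G] [TopologicalSpace G]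

/-- If `G → G / ker t` admits local sections and `G / ker t → t(G)` is a homeomorphism, then
`G → t(G)` admits local sections. -/
theorem admitsLocalSections_rangeRestrict (X : TopCrossedModule H G)
    (hG : AdmitsLocalSections (QuotientGroup.mk : G → G ⧸ X.t.ker))
    (ht : IsHomeomorph (QuotientGroup.quotientKerEquivRange X.t : G ⧸ X.t.ker → X.t.range)) :
    AdmitsLocalSections X.t.rangeRestrict := by
  intro y
  let E := ht.homeomorph
  obtain ⟨U, hU, hy, s, hs, hsU⟩ := hG (E.symm y)
  refine ⟨E.symm ⁻¹' U, hU.preimage E.symm.continuous, hy, fun z => s (E.symm z),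
    hs.comp E.symm.continuous.continuousOn fun z hz => hz, fun z hz => ?_⟩
  have h1 : E (QuotientGroup.mk (s (E.symm z))) = z := by
    rw [hsU _ hz, E.apply_symm_apply]
  exact h1

end TopCrossedModule

/-! ### Flat sections and the shifts along them -/

namespace Bibundle

variable {H : Type uH} {G : Type uG}
  [Group H] [TopologicalSpace H] [Group G] [TopologicalSpace G]
  {X : TopCrossedModule H G} {M : Type uM} [TopologicalSpace M]

/-- `σ` is a continuous section over `W × J` of a bibundle on `M × [0, 1]`, and its value under
the structure map is `η m` at each `(m, s)`. -/
structure IsFlatSection (Q : Bibundle.{uH, uG, uM, uP} X (M × unitInterval)) (η : M → H)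
    (W : Set M) (J : Set unitInterval) (σ : M × unitInterval → Q.P) : Prop where
  continuousOn : ContinuousOn σ (W ×ˢ J)
  proj : ∀ x ∈ W ×ˢ J, Q.π (σ x) = x
  ψ_eq : ∀ x ∈ W ×ˢ J, Q.ψ (σ x) = η x.1

variable {Q : Bibundle.{uH, uG, uM, uP} X (M × unitInterval)}

theorem IsFlatSection.mono {η : M → H} {W W' : Set M} {J J' : Set unitInterval}
    {σ : M × unitInterval → Q.P} (h : Q.IsFlatSection η W J σ) (hW : W' ⊆ W) (hJ : J' ⊆ J) :
    Q.IsFlatSection η W' J' σ :=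
  ⟨h.continuousOn.mono (Set.prod_mono hW hJ), fun x hx => h.proj x (Set.prod_mono hW hJ hx),
    fun x hx => h.ψ_eq x (Set.prod_mono hW hJ hx)⟩

variable [IsTopologicalGroup G]

/-- For any local section `s`, equality of types puts `y = η⁻¹ ψ(s)` in `t(G)`. A continuous lift
`r(y)` to `G` corrects `s`: `ψ(s r(y)⁻¹) = ψ(s) y⁻¹ = η`. -/
theorem exists_local_isFlatSection [IsTopologicalGroup H]
    (ht : AdmitsLocalSections X.t.rangeRestrict)
    {η : M → H} {W₀ : Set M} (hW₀ : IsOpen W₀) (hη : ContinuousOn η W₀)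
    (hQ : ∀ x : M × unitInterval, x.1 ∈ W₀ → Q.typeMap x = (η x.1 : H ⧸ X.t.range))
    (x₀ : M × unitInterval) (hx₀ : x₀.1 ∈ W₀) :
    ∃ W : Set M, IsOpen W ∧ x₀.1 ∈ W ∧ ∃ J : Set unitInterval, IsOpen J ∧ x₀.2 ∈ J ∧
      ∃ σ, Q.IsFlatSection η W J σ := by
  obtain ⟨U, hU, hxU, s, hs, hsU⟩ := Q.isPrincipal.exists_local_section x₀
  have hmem : ∀ x ∈ U ∩ Prod.fst ⁻¹' W₀, (η x.1)⁻¹ * Q.ψ (s x) ∈ X.t.range := by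
    intro x hx
    rw [← QuotientGroup.eq, ← hQ x hx.2, ← Q.typeMap_apply, hsU x hx.1]
  have hO : IsOpen (U ∩ Prod.fst ⁻¹' W₀) := hU.inter (hW₀.preimage continuous_fst)
  classical
  let y : M × unitInterval → X.t.range := fun x =>
    if hx : x ∈ U ∩ Prod.fst ⁻¹' W₀ then ⟨_, hmem x hx⟩ else 1
  have hyv : ∀ x ∈ U ∩ Prod.fst ⁻¹' W₀, (y x : H) = (η x.1)⁻¹ * Q.ψ (s x) := by
    intro x hx
    simp only [y, dif_pos hx]
  -- Continuity is needed into the subspace `t(G)`, where the local sections of `G → t(G)` are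
  -- defined.
  have hy : ContinuousOn y (U ∩ Prod.fst ⁻¹' W₀) := by
    refine Topology.IsInducing.subtypeVal.continuousOn_iff.2 (ContinuousOn.congr ?_ hyv)
    exact ((hη.comp continuous_fst.continuousOn fun x hx => hx.2).inv).mul
      (Q.continuous_ψ.comp_continuousOn (hs.mono Set.inter_subset_left))
  obtain ⟨V, hV, hyV, r, hr, hrV⟩ := ht (y x₀)
  have hO' := hy.isOpen_inter_preimage hO hV
  obtain ⟨W, J, hW, hJ, hxW, hxJ, hWJ⟩ := isOpen_prod_iff.1 hO' x₀.1 x₀.2 ⟨⟨hxU, hx₀⟩, hyV⟩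
  refine ⟨W, hW, hxW, J, hJ, hxJ, fun x => s x <• (r (y x))⁻¹, ?_, fun x hx => ?_, fun x hx => ?_⟩
  · refine Q.isPrincipal.continuous_act.comp_continuousOn
      ((hs.mono fun x hx => (hWJ hx).1.1).prodMk (ContinuousOn.inv ?_))
    exact hr.comp (hy.mono fun x hx => (hWJ hx).1) fun x hx => (hWJ hx).2
  · rw [Q.isPrincipal.proj_act, hsU x (hWJ hx).1.1]
  · have h1 : X.t (r (y x)) = y x := congrArg Subtype.val (hrV (y x) (hWJ hx).2)
    rw [Q.ψ_act, map_inv, h1, hyv x (hWJ hx).1]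
    group

/-- Flat sections over `W₁ × [0, a]` and `W₂ × [a, b]` can be glued. -/
theorem IsFlatSection.exists_glue {η : M → H} {W₁ W₂ : Set M} {a b : unitInterval} (hab : a ≤ b)
    {σ₁ σ₂ : M × unitInterval → Q.P} (h₁ : Q.IsFlatSection η W₁ (Set.Icc 0 a) σ₁)
    (h₂ : Q.IsFlatSection η W₂ (Set.Icc a b) σ₂) :
    ∃ σ, Q.IsFlatSection η (W₁ ∩ W₂) (Set.Icc 0 b) σ := by
  classical
  -- `k` turns `σ₂` into `σ₁` at time `a`. Both have structure value `η` there, so `k` lies in `ker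
  -- t`, and multiplying `σ₂` by `k` at all later times keeps it flat.
  let k : M → G := fun m => Q.isPrincipal.divide (σ₂ (m, a)) (σ₁ (m, a))
  have hm₁ : ∀ m ∈ W₁ ∩ W₂, (m, a) ∈ W₁ ×ˢ Set.Icc (0 : unitInterval) a :=
    fun m hm => ⟨hm.1, a.2.1, le_rfl⟩
  have hm₂ : ∀ m ∈ W₁ ∩ W₂, (m, a) ∈ W₂ ×ˢ Set.Icc a b :=
    fun m hm => ⟨hm.2, le_rfl, hab⟩
  have hπ : ∀ m ∈ W₁ ∩ W₂, Q.π (σ₂ (m, a)) = Q.π (σ₁ (m, a)) := fun m hm => by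
    rw [h₁.proj _ (hm₁ m hm), h₂.proj _ (hm₂ m hm)]
  have hk : ∀ m ∈ W₁ ∩ W₂, σ₂ (m, a) <• k m = σ₁ (m, a) := fun m hm =>
    Q.isPrincipal.act_divide (hπ m hm)
  have htk : ∀ m ∈ W₁ ∩ W₂, X.t (k m) = 1 := fun m hm => by
    have := Q.ψ_act (σ₂ (m, a)) (k m)
    rw [hk m hm, h₁.ψ_eq _ (hm₁ m hm), h₂.ψ_eq _ (hm₂ m hm)] at this
    exact left_eq_mul.1 this
  have hkc : ContinuousOn k (W₁ ∩ W₂) := by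
    refine Q.isPrincipal.continuousOn_divide.comp (ContinuousOn.prodMk ?_ ?_) hπ
    · exact h₂.continuousOn.comp (continuous_id.prodMk continuous_const).continuousOn hm₂
    · exact h₁.continuousOn.comp (continuous_id.prodMk continuous_const).continuousOn hm₁
  refine ⟨fun x => if x.2 ≤ a then σ₁ x else σ₂ x <• k x.1, ?_, ?_, ?_⟩
  · rw [continuousOn_iff_continuous_domRestrict]
    refine continuous_if_le (continuous_snd.comp continuous_subtype_val) continuous_const
      (h₁.continuousOn.comp continuous_subtype_val.continuousOn
        fun x hx => ⟨x.2.1.1, x.2.2.1, hx⟩)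
      (Q.isPrincipal.continuous_act.comp_continuousOn (ContinuousOn.prodMk
        (h₂.continuousOn.comp continuous_subtype_val.continuousOn
          fun x hx => ⟨x.2.1.2, hx, x.2.2.2⟩)
        (hkc.comp (continuous_fst.comp continuous_subtype_val).continuousOn
          fun x _ => x.2.1))) ?_
    rintro ⟨⟨m, s⟩, hx⟩ hs
    obtain rfl : s = a := hs
    exact (hk m hx.1).symm
  · intro x hx
    split_ifs with hs
    · exact h₁.proj x ⟨hx.1.1, hx.2.1, hs⟩
    · rw [Q.isPrincipal.proj_act]
      exact h₂.proj x ⟨hx.1.2, (not_le.1 hs).le, hx.2.2⟩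
  · intro x hx
    split_ifs with hs
    · exact h₁.ψ_eq x ⟨hx.1.1, hx.2.1, hs⟩
    · rw [Q.ψ_act, htk _ hx.1, mul_one]
      exact h₂.ψ_eq x ⟨hx.1.2, (not_le.1 hs).le, hx.2.2⟩

/-- If the type map of `Q` does not depend on the interval coordinate, then `Q` has flat sections
over `W × [0, 1]` for small open sets `W`. -/
theorem exists_isFlatSection [IsTopologicalGroup H]
    (ht : AdmitsLocalSections X.t.rangeRestrict)
    (hH : AdmitsLocalSections (QuotientGroup.mk : H → H ⧸ X.t.range))
    (τ : C(M, H ⧸ X.t.range)) (hQ : ∀ x, Q.typeMap x = τ x.1) (m : M) :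
    ∃ W : Set M, IsOpen W ∧ m ∈ W ∧ ∃ η σ, Q.IsFlatSection η W Set.univ σ := by
  obtain ⟨U, hU, hm, r, hr, hrU⟩ := hH (τ m)
  have hη : ContinuousOn (fun x => r (τ x)) (τ ⁻¹' U) :=
    hr.comp τ.continuous.continuousOn fun x hx => hx
  have hloc := fun s : unitInterval => exists_local_isFlatSection (Q := Q) ht
    (hU.preimage τ.continuous) hη (fun x hx => (hQ x).trans (hrU _ hx).symm) (m, s) hm
  choose W hW hmW J hJ hsJ σ hσ using hloc
  -- A subdivision of `[0,1]` with each piece inside some `J i`; only finitely many gluings are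
  -- needed, so the intersection of the sets `W i` involved stays open.
  obtain ⟨T, hT0, hTm, ⟨N, hN⟩, hT⟩ := exists_monotone_Icc_subset_open_cover_unitInterval hJ
    fun s _ => Set.mem_iUnion.2 ⟨s, hsJ s⟩
  have key : ∀ n, ∃ V : Set M, IsOpen V ∧ m ∈ V ∧
      ∃ σ, Q.IsFlatSection (fun x => r (τ x)) V (Set.Icc 0 (T n)) σ := by
    intro n
    induction n with
    | zero =>
      obtain ⟨i, hi⟩ := hT 0
      refine ⟨W i, hW i, hmW i, σ i, (hσ i).mono subset_rfl ?_⟩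
      rw [← hT0] at *
      -- The initial interval is the single point `T 0 = 0`, contained in the first piece `[T 0, T
      -- 1]`.
      exact (Set.Icc_subset_Icc le_rfl (hTm (Nat.zero_le 1))).trans hi
    | succ n ih =>
      obtain ⟨V, hV, hmV, σ', hσ'⟩ := ih
      obtain ⟨i, hi⟩ := hT n
      exact ⟨V ∩ W i, hV.inter (hW i), ⟨hmV, hmW i⟩,
        hσ'.exists_glue (hTm (Nat.le_succ n)) ((hσ i).mono subset_rfl hi)⟩
  obtain ⟨V, hV, hmV, σ', hσ'⟩ := key N
  refine ⟨V, hV, hmV, _, σ', hσ'.mono subset_rfl fun s _ => ?_⟩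
  rw [hN N le_rfl]
  exact ⟨s.2.1, s.2.2⟩

/-- A bibundle map of `Q` to itself that covers `(m, s) ↦ (m, min (s + ρ m) 1)`, and is the
identity where `ρ` vanishes. -/
structure IsShift (Q : Bibundle.{uH, uG, uM, uP} X (M × unitInterval)) (ρ : M → ℝ)
    (Φ : Q.P → Q.P) : Prop where
  continuous : Continuous Φ
  proj : ∀ q, Q.π (Φ q) = ((Q.π q).1, Set.projIcc 0 1 zero_le_one ((Q.π q).2 + ρ (Q.π q).1))
  act : ∀ (q : Q.P) (g : G), Φ (q <• g) = Φ q <• g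
  ψ_eq : ∀ q, Q.ψ (Φ q) = Q.ψ q
  eq_self : ∀ q, ρ (Q.π q).1 = 0 → Φ q = q

/-- Over `W`, write `q = σ(x) g` with `x = π(q)` and send it to `σ(x') g`, where `x'` is the shifted
point; both have structure value `η t(g)`. The support condition lets this be extended by the
identity. -/
theorem IsFlatSection.exists_isShift {η : M → H} {W : Set M} (hW : IsOpen W)
    {σ : M × unitInterval → Q.P} (h : Q.IsFlatSection η W Set.univ σ)
    {ρ : M → ℝ} (hρ : Continuous ρ) (hρW : tsupport ρ ⊆ W) : ∃ Φ, Q.IsShift ρ Φ := by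
  classical
  let sh : M × unitInterval → M × unitInterval := fun x =>
    (x.1, Set.projIcc 0 1 zero_le_one (x.2 + ρ x.1))
  have hsh : Continuous sh := continuous_fst.prodMk (continuous_projIcc.comp
    ((continuous_subtype_val.comp continuous_snd).add (hρ.comp continuous_fst)))
  have hsh0 : ∀ x, ρ x.1 = 0 → sh x = x := fun x hx => by
    simp only [sh, hx, add_zero, Set.projIcc_val]
  let Φ : Q.P → Q.P := fun q =>
    if (Q.π q).1 ∈ W then σ (sh (Q.π q)) <• Q.isPrincipal.divide (σ (Q.π q)) q else q
  have hπ : ∀ q, (Q.π q).1 ∈ W → Q.π (σ (Q.π q)) = Q.π q := fun q hq =>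
    h.proj _ ⟨hq, trivial⟩
  have hpos : ∀ q, (Q.π q).1 ∈ W →
      Φ q = σ (sh (Q.π q)) <• Q.isPrincipal.divide (σ (Q.π q)) q := fun q hq => if_pos hq
  have hneg : ∀ q, (Q.π q).1 ∉ W → Φ q = q := fun q hq => if_neg hq
  have hρ0 : ∀ m, m ∉ W → ρ m = 0 := fun m hm =>
    image_eq_zero_of_notMem_tsupport fun h' => hm (hρW h')
  have hself : ∀ q, ρ (Q.π q).1 = 0 → Φ q = q := fun q hq => by
    by_cases hqW : (Q.π q).1 ∈ W
    · rw [hpos q hqW, hsh0 _ hq, Q.isPrincipal.act_divide (hπ q hqW)]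
    · exact hneg q hqW
  have hcπ := Q.isPrincipal.continuous_proj
  refine ⟨Φ, ?_, ?_, ?_, ?_, hself⟩
  · rw [continuous_iff_continuousAt]
    intro q
    by_cases hq : (Q.π q).1 ∈ W
    · have hO : IsOpen {q | (Q.π q).1 ∈ W} := hW.preimage (continuous_fst.comp hcπ)
      refine (ContinuousOn.congr ?_ hpos).continuousAt (hO.mem_nhds hq)
      refine Q.isPrincipal.continuous_act.comp_continuousOn (ContinuousOn.prodMk ?_ ?_)
      · exact h.continuousOn.comp (hsh.comp hcπ).continuousOn fun q hq => ⟨hq, trivial⟩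
      · exact Q.isPrincipal.continuousOn_divide.comp
          ((h.continuousOn.comp hcπ.continuousOn fun q hq => ⟨hq, trivial⟩).prodMk
            continuousOn_id) hπ
    -- A point outside `W` has a neighbourhood missing the closed support of `ρ`, and there the
    -- shift is the identity.
    · have hO : IsOpen {q | (Q.π q).1 ∉ tsupport ρ} :=
        (isClosed_tsupport ρ).isOpen_compl.preimage (continuous_fst.comp hcπ)
      exact (continuousOn_id.congr fun q hq =>
        hself q (image_eq_zero_of_notMem_tsupport hq)).continuousAt
        (hO.mem_nhds fun h' => hq (hρW h'))
  · intro q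
    change _ = sh (Q.π q)
    by_cases hq : (Q.π q).1 ∈ W
    · rw [hpos q hq, Q.isPrincipal.proj_act]
      exact h.proj _ ⟨hq, trivial⟩
    · rw [hneg q hq, hsh0 _ (hρ0 _ hq)]
  · intro q g
    have hg := Q.isPrincipal.proj_act q g
    by_cases hq : (Q.π q).1 ∈ W
    · rw [hpos q hq, hpos (q <• g) (hg ▸ hq), hg, Q.isPrincipal.divide_act (hπ q hq),
        rightAction_rightAction]
    · rw [hneg q hq, hneg (q <• g) (hg ▸ hq)]
  · intro q
    by_cases hq : (Q.π q).1 ∈ W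
    · have h1 := congrArg Q.ψ (Q.isPrincipal.act_divide (hπ q hq))
      rw [Q.ψ_act, h.ψ_eq _ ⟨hq, trivial⟩] at h1
      rw [hpos q hq, Q.ψ_act, h.ψ_eq (sh (Q.π q)) ⟨hq, trivial⟩]
      exact h1
    · rw [hneg q hq]

end Bibundle

/-- Allows indices with vanishing shift to be dropped from an ordered composite without disturbing
the order of the rest. -/
theorem Finset.sort_filter {ι : Type*} [LinearOrder ι] (s : Finset ι) (p : ι → Prop)
    [DecidablePred p] : (s.filter p).sort (· ≤ ·) = (s.sort (· ≤ ·)).filter p := by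
  refine List.Perm.eq_of_pairwise (le := (· ≤ ·)) (fun a b _ _ => le_antisymm)
    (Finset.pairwise_sort _ _) ((Finset.pairwise_sort s _).filter _) ?_
  refine (List.perm_ext_iff_of_nodup (Finset.sort_nodup _ _)
    ((Finset.sort_nodup s _).filter _)).2 fun a => ?_
  simp

/-! ### Ordered composites of shifts and transport from time 0 to time 1 -/

namespace Bibundle

variable {H : Type uH} {G : Type uG}
  [Group H] [TopologicalSpace H] [Group G] [TopologicalSpace G]
  {X : TopCrossedModule H G} {M : Type uM} [TopologicalSpace M]
  {Q : Bibundle.{uH, uG, uM, uP} X (M × unitInterval)}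

/-- The composite of a list of self-maps of the total space. -/
def shiftList {ι : Type*} (Φ : ι → Q.P → Q.P) (l : List ι) (q : Q.P) : Q.P :=
  l.foldl (fun q i => Φ i q) q

section shiftList

variable {ι : Type*} {ρ : ι → M → ℝ} {Φ : ι → Q.P → Q.P}

theorem continuous_shiftList (h : ∀ i, Q.IsShift (ρ i) (Φ i)) (l : List ι) :
    Continuous (Q.shiftList Φ l) := by
  induction l with
  | nil => exact continuous_id
  | cons i l ih => exact ih.comp (h i).continuous

theorem shiftList_act (h : ∀ i, Q.IsShift (ρ i) (Φ i)) (l : List ι) (q : Q.P) (g : G) :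
    Q.shiftList Φ l (q <• g) = Q.shiftList Φ l q <• g := by
  induction l generalizing q with
  | nil => rfl
  | cons i l ih =>
    change Q.shiftList Φ l (Φ i (q <• g)) = _
    rw [(h i).act, ih]
    rfl

theorem ψ_shiftList (h : ∀ i, Q.IsShift (ρ i) (Φ i)) (l : List ι) (q : Q.P) :
    Q.ψ (Q.shiftList Φ l q) = Q.ψ q := by
  induction l generalizing q with
  | nil => rfl
  | cons i l ih => exact (ih (Φ i q)).trans ((h i).ψ_eq q)

theorem π_shiftList_fst (h : ∀ i, Q.IsShift (ρ i) (Φ i)) (l : List ι) (q : Q.P) :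
    (Q.π (Q.shiftList Φ l q)).1 = (Q.π q).1 := by
  induction l generalizing q with
  | nil => rfl
  | cons i l ih => exact (ih (Φ i q)).trans (congrArg (fun x => x.1) ((h i).proj q))

/-- All shifts are nonnegative, so truncating at `1` after each one agrees with truncating the total
once. Shifts preserve the `M`-coordinate, so every `ρ i` is evaluated at the same point. -/
theorem π_shiftList_snd (h : ∀ i, Q.IsShift (ρ i) (Φ i)) (hρ : ∀ i m, 0 ≤ ρ i m)
    (l : List ι) (q : Q.P) :
    ((Q.π (Q.shiftList Φ l q)).2 : ℝ) =
      min 1 ((Q.π q).2 + (l.map fun i => ρ i (Q.π q).1).sum) := by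
  induction l generalizing q with
  | nil => simpa [shiftList] using (Q.π q).2.2.2
  | cons i l ih =>
    have h0 : 0 ≤ ((Q.π q).2 : ℝ) + ρ i (Q.π q).1 := add_nonneg (Q.π q).2.2.1 (hρ _ _)
    have hs : 0 ≤ (l.map fun i => ρ i (Q.π q).1).sum :=
      List.sum_nonneg fun x hx => by
        obtain ⟨j, -, rfl⟩ := List.mem_map.1 hx
        exact hρ _ _
    refine (ih (Φ i q)).trans ?_
    rw [(h i).proj, List.map_cons, List.sum_cons, Set.coe_projIcc]
    dsimp only
    rw [max_eq_right (le_min zero_le_one h0), ← add_assoc, ← min_add_add_right, ← min_assoc,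
      min_eq_left (le_add_of_nonneg_right hs)]

theorem shiftList_filter (h : ∀ i, Q.IsShift (ρ i) (Φ i)) (p : ι → Prop) [DecidablePred p]
    (l : List ι) (q : Q.P) (hp : ∀ i, ¬ p i → ρ i (Q.π q).1 = 0) :
    Q.shiftList Φ (l.filter p) q = Q.shiftList Φ l q := by
  induction l generalizing q with
  | nil => rfl
  | cons i l ih =>
    have hq : ∀ j, ¬ p j → ρ j (Q.π (Φ i q)).1 = 0 := by
      rw [(h i).proj]
      exact hp
    by_cases hi : p i
    · rw [List.filter_cons_of_pos (by simpa using hi)]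
      exact ih (Φ i q) hq
    · rw [List.filter_cons_of_neg (by simpa using hi), ih q hp]
      change _ = Q.shiftList Φ l (Φ i q)
      rw [(h i).eq_self q (hp i hi)]

end shiftList

/-- The ordered composite of the shifts by the functions of a partition of unity moves the fibres
over `M × {0}` to those over `M × {1}`. -/
theorem exists_transport {ι : Type*} (ρ : PartitionOfUnity ι M) {Φ : ι → Q.P → Q.P}
    (h : ∀ i, Q.IsShift (ρ i) (Φ i)) :
    ∃ T : Q.P → Q.P, Continuous T ∧ (∀ q, Q.π (T q) = ((Q.π q).1, 1)) ∧
      (∀ (q : Q.P) (g : G), T (q <• g) = T q <• g) ∧ ∀ q, Q.ψ (T q) = Q.ψ q := by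
  classical
  -- Shifts along different flat sections need not commute; one global order of the indices makes
  -- the local composites agree.
  let _ : LinearOrder ι := IsWellOrder.linearOrder (WellOrderingRel (α := ι))
  have hρ0 : ∀ i m, 0 ≤ ρ i m := fun i m => ρ.nonneg i m
  let T : Q.P → Q.P := fun q =>
    Q.shiftList Φ ((ρ.finsupport (Q.π q).1).sort (· ≤ ·)) q
  -- Enlarging the finite index set only inserts identities. By local finiteness one set `F` serves
  -- a whole neighbourhood, where `T` is thus a fixed finite composite of continuous maps.
  have hT : ∀ (q : Q.P) (F : Finset ι), ρ.finsupport (Q.π q).1 ⊆ F →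
      T q = Q.shiftList Φ (F.sort (· ≤ ·)) q := by
    intro q F hF
    have h1 : ρ.finsupport (Q.π q).1 = F.filter fun i => i ∈ ρ.finsupport (Q.π q).1 := by
      rw [Finset.filter_mem_eq_inter, Finset.inter_eq_right.2 hF]
    change Q.shiftList Φ ((ρ.finsupport (Q.π q).1).sort (· ≤ ·)) q = _
    rw [h1, Finset.sort_filter]
    refine shiftList_filter h _ _ q fun i hi => ?_
    rw [PartitionOfUnity.mem_finsupport] at hi
    exact Function.notMem_support.1 hi
  refine ⟨T, ?_, ?_, ?_, fun q => ψ_shiftList h _ q⟩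
  · rw [continuous_iff_continuousAt]
    intro q
    obtain ⟨F, hF⟩ := ρ.locallyFinite.exists_finset_support (Q.π q).1
    have hn := (continuous_fst.comp Q.isPrincipal.continuous_proj).continuousAt.eventually hF
    refine (continuous_shiftList h (F.sort (· ≤ ·))).continuousAt.congr ?_
    filter_upwards [hn] with q' hq'
    refine (hT q' F fun i hi => ?_).symm
    exact hq' ((ρ.mem_finsupport _).1 hi)
  · intro q
    refine Prod.ext (π_shiftList_fst h _ q) (Subtype.ext ?_)
    refine (π_shiftList_snd h hρ0 _ q).trans ?_
    have h1 : (((ρ.finsupport (Q.π q).1).sort (· ≤ ·)).map fun i => ρ i (Q.π q).1).sum = 1 := by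
      rw [← ρ.sum_finsupport (Set.mem_univ (Q.π q).1), ← List.sum_toFinset _
        (Finset.sort_nodup _ _), Finset.sort_toFinset]
    rw [h1]
    exact min_eq_left (le_add_of_nonneg_left (Q.π q).2.2.1)
  · intro q g
    change Q.shiftList Φ _ _ = Q.shiftList Φ _ _ <• g
    rw [Q.isPrincipal.proj_act, shiftList_act h]

end Bibundle

/-! ### Homotopy invariance of the pullback -/

theorem mainTheorem4 {H : Type uH} {G : Type uG}
    [Group H] [TopologicalSpace H] [IsTopologicalGroup H]
    [Group G] [TopologicalSpace G] [IsTopologicalGroup G]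
    (X : TopCrossedModule H G)
    (hG : AdmitsLocalSections (QuotientGroup.mk : G → G ⧸ X.t.ker))
    (hH : AdmitsLocalSections (QuotientGroup.mk : H → H ⧸ X.t.range))
    (ht : IsHomeomorph (QuotientGroup.quotientKerEquivRange X.t : G ⧸ X.t.ker → X.t.range))
    {M : Type uM} [TopologicalSpace M] [T2Space M] [ParacompactSpace M]
    {N : Type uN} [TopologicalSpace N]
    (P : Bibundle.{uH, uG, uN, uP} X N)
    (τ : C(M, H ⧸ X.t.range)) (f₀ f₁ : C(M, N))
    (hf : HomotopicOver τ P.typeMap f₀ f₁) :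
    (P.pullback f₀).Isomorphic (P.pullback f₁) := by
  obtain ⟨K⟩ := hf
  let k : C(M × unitInterval, N) := ⟨fun x => K (x.2, x.1), K.continuous.comp continuous_swap⟩
  have hk0 : ∀ m, k (m, 0) = f₀ m := fun m => K.apply_zero m
  have hk1 : ∀ m, k (m, 1) = f₁ m := fun m => K.apply_one m
  let Q := P.pullback k
  -- This is where the homotopy being over `H/t(G)` enters: the type at `(m, s)` is that of `P` at
  -- `k (m, s)`, namely `τ m`.
  have hQ : ∀ x, Q.typeMap x = τ x.1 := by
    intro x
    obtain ⟨q, rfl⟩ := Q.isPrincipal.surjective x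
    rw [Q.typeMap_apply]
    have h1 := P.typeMap_apply q.1.2
    have h2 := DFunLike.congr_fun (K.prop q.1.1.2) q.1.1.1
    rw [← q.2] at h1
    exact h1.symm.trans h2
  have hloc := Q.exists_isFlatSection (X.admitsLocalSections_rangeRestrict hG ht) hH τ hQ
  choose W hW hmW η σ hσ using hloc
  obtain ⟨ρ, hρ⟩ := PartitionOfUnity.exists_isSubordinate (s := Set.univ) isClosed_univ W hW
    fun m _ => Set.mem_iUnion.2 ⟨m, hmW m⟩
  choose Φ hΦ using fun m => (hσ m).exists_isShift (hW m) (ρ m).continuous (hρ m)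
  obtain ⟨T, hTc, hTπ, hTact, hTψ⟩ := Bibundle.exists_transport ρ hΦ
  -- The inclusion of `f₀^*P` as the part of `Q` over `M × {0}`; `T` moves it over `M × {1}`, where
  -- `Q` is `f₁^*P`.
  let a : (P.pullback f₀).P → Q.P := fun x => ⟨((x.1.1, 0), x.1.2), (hk0 _).trans x.2⟩
  have ha : Continuous a := Continuous.subtype_mk
    (((continuous_fst.comp continuous_subtype_val).prodMk continuous_const).prodMk
      (continuous_snd.comp continuous_subtype_val)) _
  have hπ1 : ∀ x, (T (a x)).1.1 = (x.1.1, 1) := fun x => hTπ (a x)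
  let F : (P.pullback f₀).P → (P.pullback f₁).P := fun x =>
    ⟨(x.1.1, (T (a x)).1.2), by rw [← hk1, ← hπ1 x]; exact (T (a x)).2⟩
  have hF : Continuous F := Continuous.subtype_mk
    ((continuous_fst.comp continuous_subtype_val).prodMk
      (continuous_snd.comp (continuous_subtype_val.comp (hTc.comp ha)))) _
  have hFact : ∀ (x : (P.pullback f₀).P) (g : G), F (x <• g) = F x <• g := fun x g =>
    Subtype.ext (Prod.ext rfl (congrArg (fun q : Q.P => q.1.2) (hTact (a x) g)))
  obtain ⟨F', hF'⟩ := (P.pullback f₀).isPrincipal.exists_homeomorph (P.pullback f₁).isPrincipal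
    F hF (fun _ => rfl) hFact
  refine ⟨F', fun p => ?_, fun p g => ?_, fun p => ?_⟩
  · rw [hF']
    rfl
  · rw [hF', hF', hFact]
  · rw [hF']
    exact hTψ (a p)
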